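/- Let $d\ge 2$, $n\ge 1$, $0\le t\le n$, $1\le f\le N=d^n$ be integers, and put $r=\lfloor\log_d f\rfloor$. **The network.** The plane $\mathrm{BY}^{-1}(n)$ has inputs and outputs labelled by strings in $\mathbb Z_d^n$ and $n$ stages of $d\times d$ switching elements labelled by strings in $\mathbb Z_d^{n-1}$. An input $x$ is attached to the element $x_1\cdots x_{n-1}$ of stage $1$ and an output $y$ to the element $y_1\cdots y_{n-1}$ of stage $n$; the element $z_1\cdots z_{n-1}$ of stage $i\le n-1$ is linked to the $d$ elements $z_1\cdots z_{i-1}*z_{i+1}\cdots z_{n-1}$, $*\in\mathbb Z_d$, of stage $i+1$. Hence there is a unique route in the plane from any input to any output. The network $\log_d(N,0,m)$ is the stack of $m$ such planes. **Requests and the window algorithm.** An $f$-cast request is a pair $(a,B)$ of an unused input $a$ and a nonempty set $B$ of at most $f$ unused outputs. To route it, choose for every $b\in B$ a plane on which the route from $a$ to $b$ is placed; on each plane, routes of different requests may not share an internal link (a link between consecutive stages). A window is the set of all $d^t$ outputs with a given prefix of length $n-t$. The window algorithm with window size $d^t$ requires that, for every window $W$, all branches of the request to outputs in $B\cap W$ are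 placed on one single plane. The network is $f$-cast nonblocking under this algorithm if, whenever $f$-cast requests arrive and are released in any order, starting from the empty network, and all of them have been routed according to the algorithm (with any choices that it leaves open), every new $f$-cast request can be routed according to the algorithm without disturbing the existing connections. **Theorem.** $\log_d(N,0,m)$ is $f$-cast nonblocking under the window algorithm with window size $d^t$ whenever $m\ge 1+C(t,f)$, where \[ C(t,f)=\begin{cases} f\left(d^{\lceil\frac{n-r}{2}\rceil-1}-1\right)+d^{\,n-\lceil\frac{n-r}{2}\rceil}-1 & t<\lfloor\frac n2\rfloor,\ r\le n-2t-1,\\[4pt] t(d-1)d^{n-t-1}+d^{n-2t-1}-1 & t<\lfloor\frac n2\rfloor,\ r\ge n-2t,\\[4pt] [(n-t-1)(d-1)-1]d^{n-t-1}+d^t-(d-1)d^{2t-n-1} & t\ge\lfloor\frac n2\rfloor,\ r\ge n-t,\\[4pt] f\left(d^{n-t-r-1}-1\right)+[r(d-1)-1]d^{n-t-1}+d^{n-t-r-1}+d^t-(d-1)d^{2t-n-1} & t\ge\lfloor\frac n2\rfloor,\ 2t-n-2<r\le n-t-1,\\[4pt] f\left(d^{n-t-r-1}-1\right)+[r(d-1)-1]d^{n-t-1}+d^{\lfloor\frac{n+r}{2}\rfloor}+f\left(d^{\,n-\lfloor\frac{n+r}{2}\rfloor-1}-1\right)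 & t\ge\lfloor\frac n2\rfloor,\ r\le\min(2t-n-2,\,n-t-1). \end{cases} \] Exponents may be negative, so $C(t,f)$ is a rational number. -/

import Mathlib

/-- `d`-ary strings of length `n`: the labels of the inputs and of the outputs.  Coordinates are
numbered from `0`, so coordinate `c` holds the symbol usually written `x_{c+1}`. -/
abbrev Word (d n : ℕ) : Type := Fin n → Fin d

/-- Labels of the `d × d` switching elements of one stage: `d`-ary strings of length `n - 1`. -/
abbrev SwitchLabel (d n : ℕ) : Type := Fin (n - 1) → Fin d

/-- The prefix of length `n - 1`, i.e. the label of the first-stage switching element to which an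
input is attached, or of the last-stage switching element to which an output is attached. -/
def Word.init {d n : ℕ} (x : Word d n) : SwitchLabel d n :=
  fun c => x (Fin.castLE (Nat.sub_le n 1) c)

/-- Internal links of the inverse Banyan plane `BY⁻¹(n)`.  The stages are numbered `0, …, n - 1`;
the switching element `z` of stage `s ≤ n - 2` is joined to the element `z'` of stage `s + 1`
exactly if `z` and `z'` agree except possibly in coordinate `s`. -/
def BanyanAdj {d n : ℕ} (s : Fin (n - 1)) (z z' : SwitchLabel d n) : Prop :=
  ∀ c : Fin (n - 1), c ≠ s → z' c = z c

/-- The link between stages `s` and `s + 1` from element `src` to element `dst`. -/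
@[ext]
structure BanyanLink (d n : ℕ) where
  stage : Fin (n - 1)
  src : SwitchLabel d n
  dst : SwitchLabel d n
  adj : BanyanAdj stage src dst

/-- `p 0, p 1, …, p (n - 1)` are the switching elements of a path from input `x` to output `y`
in the plane `BY⁻¹(n)`. -/
def IsBanyanPath {d n : ℕ} (x y : Word d n) (p : ℕ → SwitchLabel d n) : Prop :=
  p 0 = x.init ∧ p (n - 1) = y.init ∧
    ∀ s : Fin (n - 1), BanyanAdj s (p s) (p (s + 1))

/-- The switching element in stage `s` (counted from `0`) of the route from `x` to `y`:
its label is `y_1 ⋯ y_s x_{s+1} ⋯ x_{n-1}`. -/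
def routeSwitch {d n : ℕ} (x y : Word d n) (s : ℕ) : SwitchLabel d n :=
  fun c => if c.val < s then y.init c else x.init c

theorem routeSwitch_adj {d n : ℕ} (x y : Word d n) (s : Fin (n - 1)) :
    BanyanAdj s (routeSwitch x y s) (routeSwitch x y (s + 1)) := by
  intro c hc
  have h : c.val ≠ s.val := fun h => hc (Fin.ext h)
  have h' : c.val < s.val + 1 ↔ c.val < s.val := by omega
  simp only [routeSwitch, h']

/-- `routeSwitch x y` is a path from `x` to `y` in the plane. -/
theorem routeSwitch_isBanyanPath {d n : ℕ} (x y : Word d n) :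
    IsBanyanPath x y (routeSwitch x y) := by
  refine ⟨?_, ?_, routeSwitch_adj x y⟩
  · funext c
    simp [routeSwitch]
  · funext c
    simp [routeSwitch, c.isLt]

/-- The path from `x` to `y` in the plane is unique. -/
theorem IsBanyanPath.eq_routeSwitch {d n : ℕ} {x y : Word d n} {p : ℕ → SwitchLabel d n}
    (hp : IsBanyanPath x y p) {s : ℕ} (hs : s ≤ n - 1) : p s = routeSwitch x y s := by
  obtain ⟨h0, h1, hadj⟩ := hp
  have low : ∀ (c : Fin (n - 1)) (s : ℕ), s ≤ c.val → p s c = x.init c := by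
    intro c s
    induction s with
    | zero => intro _; rw [h0]
    | succ k ih =>
      intro hk
      have hlt : k < n - 1 := by omega
      have := hadj ⟨k, hlt⟩ c (by intro h; rw [h] at hk; simp at hk)
      exact this.trans (ih (by omega))
  have high : ∀ (c : Fin (n - 1)) (j : ℕ), c.val + 1 + j ≤ n - 1 →
      p (c.val + 1 + j) c = p (c.val + 1) c := by
    intro c j
    induction j with
    | zero => intro _; rfl
    | succ k ih =>
      intro hk
      have hlt : c.val + 1 + k < n - 1 := by omega
      have := hadj ⟨c.val + 1 + k, hlt⟩ c
        (by intro h; have := congrArg Fin.val h; simp only at this; omega)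
      exact this.trans (ih (by omega))
  funext c
  by_cases hc : c.val < s
  · have e1 := high c (s - (c.val + 1)) (by omega)
    have e2 := high c (n - 1 - (c.val + 1)) (by have := c.isLt; omega)
    rw [show c.val + 1 + (s - (c.val + 1)) = s by omega] at e1
    rw [show c.val + 1 + (n - 1 - (c.val + 1)) = n - 1 by have := c.isLt; omega, h1] at e2
    simp [routeSwitch, hc, e1, e2]
  · simp [routeSwitch, hc, low c s (by omega)]

/-- The internal links of a plane used by the (unique) route from input `x` to output `y`. -/
def routeLinks {d n : ℕ} (x y : Word d n) : Set (BanyanLink d n) :=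
  Set.range fun s : Fin (n - 1) =>
    ⟨s, routeSwitch x y s, routeSwitch x y (s + 1), routeSwitch_adj x y s⟩

/-- A routed multicast request in the network `log_d(d^n, 0, m)`, the stack of `m` copies of
`BY⁻¹(n)`: its input, its set of outputs, and for every `b ∈ outputs` the plane that carries the
branch from `input` to `b` (the values of `plane` outside `outputs` carry no meaning). -/
structure Connection (d n m : ℕ) where
  input : Word d n
  outputs : Finset (Word d n)
  plane : Word d n → Fin m

/-- Two connections conflict if a branch of one and a branch of the other run on the same plane
and share an internal link there. -/
def Connection.Conflict {d n m : ℕ} (c c' : Connection d n m) : Prop :=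
  ∃ b ∈ c.outputs, ∃ b' ∈ c'.outputs, c.plane b = c'.plane b' ∧
    (routeLinks c.input b ∩ routeLinks c'.input b').Nonempty

/-- Two outputs lie in the same window of size `d^t`: they share the prefix of length `n - t`. -/
def SameWindow {d n : ℕ} (t : ℕ) (b b' : Word d n) : Prop :=
  ∀ i : Fin n, i.val < n - t → b i = b' i

/-- The rule of the window algorithm with window size `d^t`: the part of the request that goes to
any one window is routed entirely on one single plane. -/
def Connection.ObeysWindowRule {d n m : ℕ} (t : ℕ) (c : Connection d n m) : Prop :=
  ∀ b ∈ c.outputs, ∀ b' ∈ c.outputs, SameWindow t b b' → c.plane b = c.plane b'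

/-- `(a, B)` is a legitimate new `f`-cast request when the connections in `S` are present: `B` is a
nonempty set of at most `f` outputs, the input `a` is unused, and all outputs in `B` are unused. -/
def IsNewRequest {d n m : ℕ} (f : ℕ) (S : Set (Connection d n m))
    (a : Word d n) (B : Finset (Word d n)) : Prop :=
  B.Nonempty ∧ B.card ≤ f ∧ ∀ c ∈ S, c.input ≠ a ∧ Disjoint c.outputs B

/-- The window algorithm may set up the connection `c` next to the connections in `S`. -/
def IsAdmissible {d n m : ℕ} (t : ℕ) (S : Set (Connection d n m)) (c : Connection d n m) : Prop :=
  c.ObeysWindowRule t ∧ ∀ c' ∈ S, ¬ c.Conflict c'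

/-- The sets of simultaneous connections that can arise, starting from the empty network, when
`f`-cast requests come and go in any order and each is routed by the window algorithm with window
size `d^t` (with any choice of planes that this algorithm permits). -/
inductive Reachable {d n m : ℕ} (f t : ℕ) : Set (Connection d n m) → Prop
  | empty : Reachable f t ∅
  | connect (S : Set (Connection d n m)) (c : Connection d n m) :
      Reachable f t S → IsNewRequest f S c.input c.outputs → IsAdmissible t S c →
        Reachable f t (insert c S)
  | release (S : Set (Connection d n m)) (c : Connection d n m) :
      Reachable f t S → c ∈ S → Reachable f t (S \ {c})

/-- `log_d(d^n, 0, m)` is `f`-cast nonblocking under the window algorithm with window size `d^t`: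
in every situation that can arise under the algorithm, every new `f`-cast request can be routed
according to the algorithm without disturbing the existing connections. -/
def IsNonblockingUnderWindow (d n m f t : ℕ) : Prop :=
  ∀ S : Set (Connection d n m), Reachable f t S →
    ∀ (a : Word d n) (B : Finset (Word d n)), IsNewRequest f S a B →
      ∃ c : Connection d n m, c.input = a ∧ c.outputs = B ∧ IsAdmissible t S c

/-- The bound `C(t, f)` for the network with parameters `d` and `n`, where `r = ⌊log_d f⌋`.
All exponents are integers, and some may be negative. -/
def planeBound (d n t f : ℕ) : ℚ :=
  let D : ℚ := d
  let N : ℤ := n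
  let T : ℤ := t
  let r : ℤ := Nat.log d f
  if T < ⌊(N : ℚ) / 2⌋ then
    if r ≤ N - 2 * T - 1 then
      f * (D ^ (⌈((N - r : ℤ) : ℚ) / 2⌉ - 1) - 1) + D ^ (N - ⌈((N - r : ℤ) : ℚ) / 2⌉) - 1
    else
      t * (D - 1) * D ^ (N - T - 1) + D ^ (N - 2 * T - 1) - 1
  else if N - T ≤ r then
    ((n - t - 1) * (D - 1) - 1) * D ^ (N - T - 1) + D ^ T - (D - 1) * D ^ (2 * T - N - 1)
  else if 2 * T - N - 2 < r then
    f * (D ^ (N - T - r - 1) - 1) + (r * (D - 1) - 1) * D ^ (N - T - 1)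
      + D ^ (N - T - r - 1) + D ^ T - (D - 1) * D ^ (2 * T - N - 1)
  else
    f * (D ^ (N - T - r - 1) - 1) + (r * (D - 1) - 1) * D ^ (N - T - 1)
      + D ^ ⌊((N + r : ℤ) : ℚ) / 2⌋ + f * (D ^ (N - ⌊((N + r : ℤ) : ℚ) / 2⌋ - 1) - 1)

/-! Branches of one request never obstruct each other, so the new request can be handled window by
window: let `W` be its part in one window, with common prefix length `u = n - t`. It suffices that
fewer than `m` planes are blocked for `W`. A branch `x → b'` blocks its plane only if, for some `j <
n`, `x` is one of `d^j - 1` inputs close to `a`, and `b'` agrees with some output of `W` in `j`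
symbols.

For cut-offs `k < e ≤ u` the blocked planes are covered by three families (`card_blockedPlanes_le`).
Inputs within level `k` use at most `f` planes each. For `k < i < e`, a window agreeing with that of
`W` in exactly `i` symbols costs one plane per input of level `i` not of level `k`, by the window
rule. The remaining "deep" planes reach outputs agreeing with `W` in `e` symbols; they are counted
either by outputs, each on one plane, or, for `e = u`, by inputs up to a second cut-off `l` and by
outputs beyond it.

The five cases of `C(t, f)` come from different choices of `k`, `e` and of the count of deep planes.
The target is "blocked planes `< 1 + C`", as `C` need not be an integer. -/

/-! ### Shared links and the sizes of input levels and prefix classes. -/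

section Counting

open Finset Classical

/-- The words `b` and `b'` agree in their first `j` coordinates. -/
def AgreeUpTo {d n : ℕ} (j : ℕ) (b b' : Word d n) : Prop :=
  ∀ i : Fin n, i.val < j → b i = b' i

theorem AgreeUpTo.mono {d n j k : ℕ} {b b' : Word d n} (h : AgreeUpTo k b b') (hjk : j ≤ k) :
    AgreeUpTo j b b' := fun i hi => h i (hi.trans_le hjk)

theorem AgreeUpTo.symm {d n j : ℕ} {b b' : Word d n} (h : AgreeUpTo j b b') :
    AgreeUpTo j b' b := fun i hi => (h i hi).symm

theorem AgreeUpTo.trans {d n j : ℕ} {b b' b'' : Word d n} (h : AgreeUpTo j b b')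
    (h' : AgreeUpTo j b' b'') : AgreeUpTo j b b'' := fun i hi => (h i hi).trans (h' i hi)

/-- The inputs `x ≠ a` whose routes can share a link between the stages `j - 1` and `j` (counted
from `0`), or an earlier one, with a route from `a`. -/
noncomputable def inputsWithin {d n : ℕ} (a : Word d n) (j : ℕ) : Finset (Word d n) :=
  {x | x ≠ a ∧ 1 ≤ j ∧ ∀ i : Fin n, j ≤ i.val + 1 → i.val + 1 < n → x i = a i}

theorem inputsWithin_mono {d n : ℕ} (a : Word d n) {j k : ℕ} (hjk : j ≤ k) :
    inputsWithin a j ⊆ inputsWithin a k := by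
  intro x hx
  simp only [inputsWithin, mem_filter, mem_univ, true_and] at hx ⊢
  exact ⟨hx.1, hx.2.1.trans hjk, fun i hi => hx.2.2 i (hjk.trans hi)⟩

/-- For a shared link leaving stage `s`, equal sources compare the tails of the inputs and equal
targets the prefixes of the outputs, so `j = s + 1`. -/
theorem exists_level_of_routeLinks_inter {d n : ℕ} {a x b b' : Word d n} (hx : x ≠ a)
    (h : (routeLinks a b ∩ routeLinks x b').Nonempty) :
    ∃ j < n, x ∈ inputsWithin a j ∧ AgreeUpTo j b b' := by
  obtain ⟨l, ⟨s, hs⟩, ⟨s', hs'⟩⟩ := h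
  have heq := hs.trans hs'.symm
  simp only [BanyanLink.mk.injEq] at heq
  obtain ⟨h1, h2, h3⟩ := heq
  subst h1
  have hlt := s.isLt
  refine ⟨s.val + 1, by omega, ?_, ?_⟩
  · simp only [inputsWithin, mem_filter, mem_univ, true_and]
    refine ⟨hx, by omega, fun i hi hi' => ?_⟩
    have := congrFun h2 ⟨i.val, by omega⟩
    simp only [routeSwitch, Word.init] at this
    rw [if_neg (by omega), if_neg (by omega)] at this
    exact this.symm
  · intro i hi
    have := congrFun h3 ⟨i.val, by omega⟩
    simp only [routeSwitch, Word.init] at this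
    rw [if_pos (by omega), if_pos (by omega)] at this
    exact this

/-- There are `d ^ k` words with prescribed symbols outside of a set of `k` coordinates. -/
theorem card_words_eq_off {d n : ℕ} (a : Word d n) (T : Finset (Fin n)) (s : Finset (Word d n))
    (hs : ∀ x, x ∈ s ↔ ∀ i, i ∉ T → x i = a i) : #s = d ^ #T := by
  have : s = Fintype.piFinset fun i => if i ∈ T then univ else {a i} := by
    ext x
    simp only [hs, Fintype.mem_piFinset]
    refine forall_congr' fun i => ?_
    by_cases h : i ∈ T <;> simp [h]
  rw [this, Fintype.card_piFinset, ← prod_const, ← prod_subset (subset_univ T)]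
  · refine prod_congr rfl fun i hi => ?_
    simp [hi]
  · intro i _ hi
    simp [hi]

theorem card_agreeUpTo {d n : ℕ} (b : Word d n) {j : ℕ} (hj : j ≤ n) :
    #(univ.filter fun x => AgreeUpTo j b x) = d ^ (n - j) := by
  rw [card_words_eq_off b (univ.filter fun i : Fin n => i.val < j)ᶜ]
  · rw [card_compl, Fin.card_filter_val_lt, Fintype.card_fin, min_eq_right hj]
  · intro x
    simp only [mem_filter, mem_univ, true_and, mem_compl, not_not]
    exact forall₂_congr fun _ _ => eq_comm

theorem card_agreeUpTo_not_succ {d n : ℕ} (b : Word d n) {j : ℕ} (hj : j < n) :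
    #(univ.filter fun x => AgreeUpTo j b x ∧ ¬ AgreeUpTo (j + 1) b x) =
      d ^ (n - j) - d ^ (n - j - 1) := by
  have h : (univ.filter fun x => AgreeUpTo j b x ∧ ¬ AgreeUpTo (j + 1) b x) =
      (univ.filter fun x => AgreeUpTo j b x) \ (univ.filter fun x => AgreeUpTo (j + 1) b x) := by
    ext x; simp
  rw [h, card_sdiff_of_subset, card_agreeUpTo b hj.le, card_agreeUpTo b hj, Nat.sub_sub]
  intro x hx
  simp only [mem_filter, mem_univ, true_and] at hx ⊢
  exact hx.mono (Nat.le_succ j)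

/-- For `j ≥ 1` the free coordinates are the first `j - 1` and the last one, which no switch label
records; the word `a` itself is excluded. -/
theorem card_inputsWithin {d n : ℕ} (a : Word d n) {j : ℕ} (hj : j ≤ n) :
    #(inputsWithin a j) = d ^ j - 1 := by
  rcases Nat.eq_zero_or_pos j with rfl | hpos
  · simp [inputsWithin]
  have hcard : #(insert ⟨n - 1, by omega⟩ (univ.filter fun i : Fin n => i.val < j - 1)) = j := by
    rw [card_insert_of_notMem (by simp; omega), Fin.card_filter_val_lt]
    omega
  have ha : a ∉ inputsWithin a j := by simp [inputsWithin]
  have h := card_words_eq_off a (insert ⟨n - 1, by omega⟩ (univ.filter fun i : Fin n => i.val < j - 1))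
    (insert a (inputsWithin a j)) fun x => by
      simp only [inputsWithin, mem_insert, mem_filter, mem_univ, true_and, Fin.ext_iff]
      constructor
      · rintro (rfl | hx) i hi
        · rfl
        · exact hx.2.2 i (by omega) (by omega)
      · intro hx
        by_cases hxa : x = a
        · exact Or.inl hxa
        · exact Or.inr ⟨hxa, hpos, fun i h1 h2 => hx i (by omega)⟩
  rw [hcard, card_insert_of_notMem ha] at h
  omega

theorem card_inputsWithin_sdiff {d n : ℕ} (hd : 1 ≤ d) (a : Word d n) {j k : ℕ} (hjk : j ≤ k)
    (hk : k ≤ n) :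
    #(inputsWithin a k \ inputsWithin a j) = d ^ k - d ^ j := by
  rw [card_sdiff_of_subset (inputsWithin_mono a hjk), card_inputsWithin a hk,
    card_inputsWithin a (hjk.trans hk)]
  have := Nat.one_le_pow j d hd
  omega

/-- The prefix of length `u` of a word. -/
def Word.prefix {d n u : ℕ} (hu : u ≤ n) (b : Word d n) : Word d u := fun i => b (Fin.castLE hu i)

theorem agreeUpTo_prefix {d n u : ℕ} (hu : u ≤ n) {j : ℕ} (hj : j ≤ u) (b b' : Word d n) :
    AgreeUpTo j (b.prefix hu) (b'.prefix hu) ↔ AgreeUpTo j b b' :=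
  ⟨fun h i hi => h ⟨i.val, hi.trans_le hj⟩ hi, fun h i hi => h (Fin.castLE hu i) hi⟩

theorem prefix_eq_prefix_iff {d n u : ℕ} (hu : u ≤ n) (b b' : Word d n) :
    b.prefix hu = b'.prefix hu ↔ AgreeUpTo u b b' := by
  rw [← agreeUpTo_prefix hu le_rfl]
  exact ⟨fun h i _ => congrFun h i, fun h => funext fun i => h i i.isLt⟩

end Counting

/-! ### Covering the blocked planes and reducing the theorem to their number. -/

section Blocking

open Finset Classical

variable {d n m f t u : ℕ}

/-- The connection from input `x` reaches the output `b` through the plane `p`. -/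
def Reaches (S : Set (Connection d n m)) (x b : Word d n) (p : Fin m) : Prop :=
  ∃ c ∈ S, c.input = x ∧ b ∈ c.outputs ∧ c.plane b = p

/-- The properties of every set of simultaneous connections that the window algorithm with windows
given by prefixes of length `u` may produce. -/
structure IsWindowState (f u : ℕ) (S : Set (Connection d n m)) : Prop where
  card_le : ∀ c ∈ S, #c.outputs ≤ f
  plane_eq : ∀ c ∈ S, ∀ b ∈ c.outputs, ∀ b' ∈ c.outputs, AgreeUpTo u b b' →
    c.plane b = c.plane b'
  input_inj : ∀ c ∈ S, ∀ c' ∈ S, c.input = c'.input → c = c'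
  eq_of_mem : ∀ c ∈ S, ∀ c' ∈ S, ∀ b ∈ c.outputs, b ∈ c'.outputs → c = c'

theorem IsWindowState.mono {S S' : Set (Connection d n m)} (h : IsWindowState f u S)
    (hS : S' ⊆ S) : IsWindowState f u S' where
  card_le c hc := h.card_le c (hS hc)
  plane_eq c hc := h.plane_eq c (hS hc)
  input_inj c hc c' hc' := h.input_inj c (hS hc) c' (hS hc')
  eq_of_mem c hc c' hc' := h.eq_of_mem c (hS hc) c' (hS hc')

theorem Reachable.isWindowState {S : Set (Connection d n m)} (h : Reachable f t S) :
    IsWindowState f (n - t) S := by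
  induction h with
  | empty => constructor <;> simp
  | release S c _ _ ih => exact ih.mono Set.sdiff_subset
  | connect S c _ hnew hadm ih =>
    obtain ⟨_, hcard, hfresh⟩ := hnew
    constructor
    · rintro c' (rfl | hc')
      exacts [hcard, ih.card_le c' hc']
    · rintro c' (rfl | hc')
      exacts [hadm.1, ih.plane_eq c' hc']
    · rintro c' (rfl | hc') c'' (rfl | hc'') he
      · rfl
      · exact absurd he.symm (hfresh c'' hc'').1
      · exact absurd he (hfresh c' hc').1
      · exact ih.input_inj c' hc' c'' hc'' he
    · rintro c' (rfl | hc') c'' (rfl | hc'') b hb hb'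
      · rfl
      · exact absurd hb (disjoint_left.mp (hfresh c'' hc'').2 hb')
      · exact absurd hb' (disjoint_left.mp (hfresh c' hc').2 hb)
      · exact ih.eq_of_mem c' hc' c'' hc'' b hb hb'

variable {S : Set (Connection d n m)}

theorem IsWindowState.card_planes_le (h : IsWindowState f u S) (x : Word d n) :
    #(univ.filter fun p => ∃ b, Reaches S x b p) ≤ f := by
  by_cases hx : ∃ c ∈ S, c.input = x
  · obtain ⟨c, hc, rfl⟩ := hx
    refine le_trans (card_le_card ?_) ((card_image_le (f := c.plane)).trans (h.card_le c hc))
    intro p hp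
    obtain ⟨b, c', hc', he, hb, hbp⟩ := (mem_filter.mp hp).2
    obtain rfl := h.input_inj c' hc' c hc he
    exact mem_image.mpr ⟨b, hb, hbp⟩
  · rw [filter_eq_empty_iff.mpr]
    · simp
    · rintro p _ ⟨b, c, hc, he, _⟩
      exact hx ⟨c, hc, he⟩

theorem IsWindowState.card_planes_window_le (h : IsWindowState f u S) (hu : u ≤ n)
    (x : Word d n) (v : Word d u) :
    #(univ.filter fun p => ∃ b, b.prefix hu = v ∧ Reaches S x b p) ≤ 1 := by
  refine card_le_one.mpr fun p hp p' hp' => ?_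
  obtain ⟨b, hv, c, hc, he, hb, hp⟩ := (mem_filter.mp hp).2
  obtain ⟨b', hv', c', hc', he', hb', hp'⟩ := (mem_filter.mp hp').2
  obtain rfl := h.input_inj c hc c' hc' (he.trans he'.symm)
  rw [← hp, ← hp']
  exact h.plane_eq c hc b hb b' hb' ((prefix_eq_prefix_iff hu b b').mp (hv.trans hv'.symm))

theorem IsWindowState.card_planes_output_le (h : IsWindowState f u S) (b : Word d n) :
    #(univ.filter fun p => ∃ x, Reaches S x b p) ≤ 1 := by
  refine card_le_one.mpr fun p hp p' hp' => ?_
  obtain ⟨x, c, hc, -, hb, hp⟩ := (mem_filter.mp hp).2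
  obtain ⟨x', c', hc', -, hb', hp'⟩ := (mem_filter.mp hp').2
  obtain rfl := h.eq_of_mem c hc c' hc' b hb hb'
  rw [← hp, ← hp']

/-- The existing branch from `x` to `b'` shares a link with a route from `a` to an output in the
part `W` of a window. -/
def Meets (a : Word d n) (W : Finset (Word d n)) (x b' : Word d n) : Prop :=
  ∃ j < n, x ∈ inputsWithin a j ∧ ∃ b ∈ W, AgreeUpTo j b b'

/-- The planes on which no route from `a` to all outputs in `W` can be placed. -/
noncomputable def blockedPlanes (S : Set (Connection d n m)) (a : Word d n)
    (W : Finset (Word d n)) : Finset (Fin m) :=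
  univ.filter fun p => ∃ x b', Reaches S x b' p ∧ Meets a W x b'

/-- The blocked planes carrying a branch from an input outside `inputsWithin a k` to an output
agreeing with `b₀` in the first `e` coordinates. -/
noncomputable def deepPlanes (S : Set (Connection d n m)) (a : Word d n)
    (W : Finset (Word d n)) (k e : ℕ) (b₀ : Word d n) : Finset (Fin m) :=
  univ.filter fun p => ∃ x b', Reaches S x b' p ∧ Meets a W x b' ∧
    x ∉ inputsWithin a k ∧ AgreeUpTo e b₀ b'

theorem lt_of_mem_inputsWithin {a x : Word d n} {j k : ℕ} (hx : x ∈ inputsWithin a j)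
    (hk : x ∉ inputsWithin a k) : k < j :=
  not_le.mp fun h => hk (inputsWithin_mono a h hx)

theorem exists_exact_depth {b b' : Word d n} {j e : ℕ} (hj : AgreeUpTo j b b')
    (he : ¬ AgreeUpTo e b b') :
    ∃ i, j ≤ i ∧ i < e ∧ AgreeUpTo i b b' ∧ ¬ AgreeUpTo (i + 1) b b' := by
  induction e with
  | zero => exact absurd (fun i hi => absurd hi (Nat.not_lt_zero _)) he
  | succ e ih =>
    by_cases h : AgreeUpTo e b b'
    · refine ⟨e, ?_, Nat.lt_succ_self e, h, he⟩
      by_contra hlt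
      exact he (hj.mono (by omega))
    · obtain ⟨i, h1, h2, h3⟩ := ih h
      exact ⟨i, h1, by omega, h3⟩

/-- The three summands are near inputs, intermediate windows sorted by their exact agreement `i`
with `b₀`, and the deep rest. -/
theorem IsWindowState.card_blockedPlanes_le (h : IsWindowState f u S) (hd : 1 ≤ d) (hu : u ≤ n)
    (a b₀ : Word d n) {W : Finset (Word d n)} (hW : ∀ b ∈ W, AgreeUpTo u b₀ b)
    {k e : ℕ} (hk : k ≤ n) (he : e ≤ u) :
    #(blockedPlanes S a W) ≤ (d ^ k - 1) * f +
      ∑ i ∈ Ioo k e, (d ^ i - d ^ k) * (d ^ (u - i) - d ^ (u - i - 1)) +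
      #(deepPlanes S a W k e b₀) := by
  have hsub : blockedPlanes S a W ⊆
      ((inputsWithin a k).biUnion fun x => univ.filter fun p => ∃ b, Reaches S x b p) ∪
      ((Ioo k e).biUnion fun i =>
        ((inputsWithin a i \ inputsWithin a k) ×ˢ (univ.filter fun v =>
          AgreeUpTo i (b₀.prefix hu) v ∧ ¬ AgreeUpTo (i + 1) (b₀.prefix hu) v)).biUnion
          fun q => univ.filter fun p => ∃ b, b.prefix hu = q.2 ∧ Reaches S q.1 b p) ∪
      deepPlanes S a W k e b₀ := by
    intro p hp
    obtain ⟨x, b', hR, hM⟩ := (mem_filter.mp hp).2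
    simp only [mem_union, mem_biUnion, mem_filter, mem_univ, true_and, mem_product, mem_sdiff,
      mem_Ioo, Prod.exists, deepPlanes]
    by_cases hxk : x ∈ inputsWithin a k
    · exact Or.inl (Or.inl ⟨x, hxk, b', hR⟩)
    by_cases hb' : AgreeUpTo e b₀ b'
    · exact Or.inr ⟨x, b', hR, hM, hxk, hb'⟩
    refine Or.inl (Or.inr ?_)
    obtain ⟨j, hj, hxj, b, hb, hbb'⟩ := hM
    -- `W` is known to agree with `b₀` only up to `u`. Since the exact depth satisfies `min j u ≤ i
    -- < e ≤ u`, it follows that `j ≤ i`, so `x` has level `i`.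
    have hju : AgreeUpTo (min j u) b₀ b' :=
      ((hW b hb).mono (min_le_right j u)).trans (hbb'.mono (min_le_left j u))
    obtain ⟨i, h1, h2, h3, h4⟩ := exists_exact_depth hju hb'
    have hji : j ≤ i := by omega
    have hkj := lt_of_mem_inputsWithin hxj hxk
    refine ⟨i, ⟨by omega, h2⟩, x, b'.prefix hu, ⟨⟨inputsWithin_mono a hji hxj, hxk⟩, ?_, ?_⟩,
      b', rfl, hR⟩
    · exact (agreeUpTo_prefix hu (by omega) _ _).mpr h3
    · exact fun hc => h4 ((agreeUpTo_prefix hu (by omega) _ _).mp hc)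
  refine (card_le_card hsub).trans ((card_union_le _ _).trans (Nat.add_le_add_right
    ((card_union_le _ _).trans (Nat.add_le_add ?_ (card_biUnion_le.trans
      (sum_le_sum fun i hi => ?_)))) _))
  · rw [← card_inputsWithin a hk]
    exact card_biUnion_le_card_mul _ _ _ fun x _ => h.card_planes_le x
  · have hi' := mem_Ioo.mp hi
    rw [← card_inputsWithin_sdiff hd a hi'.1.le (by omega),
      ← card_agreeUpTo_not_succ (b₀.prefix hu) (by omega), ← card_product]
    refine (card_biUnion_le_card_mul _ _ 1 fun q _ => ?_).trans_eq (mul_one _)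
    exact h.card_planes_window_le hu q.1 q.2

/-- Every output carries at most one branch, and those in `W` are still unused. -/
theorem IsWindowState.card_deepPlanes_le_outputs (h : IsWindowState f u S)
    {a b₀ : Word d n} {W : Finset (Word d n)} (hW : ∀ b ∈ W, AgreeUpTo u b₀ b)
    (hnew : ∀ c ∈ S, Disjoint c.outputs W) {k e : ℕ} (he : e ≤ u) (hu : u ≤ n) :
    #(deepPlanes S a W k e b₀) ≤ d ^ (n - e) - #W := by
  have hWe : W ⊆ univ.filter fun b => AgreeUpTo e b₀ b := fun b hb =>
    mem_filter.mpr ⟨mem_univ b, (hW b hb).mono he⟩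
  rw [← card_agreeUpTo b₀ (he.trans hu), ← card_sdiff_of_subset hWe]
  refine le_trans (card_le_card ?_) ((card_biUnion_le_card_mul _ _ 1 fun b _ =>
    h.card_planes_output_le b).trans_eq (mul_one _))
  intro p hp
  obtain ⟨x, b', hR, -, -, hb'⟩ := (mem_filter.mp hp).2
  simp only [mem_biUnion, mem_filter, mem_univ, true_and, mem_sdiff]
  refine ⟨b', ⟨hb', fun hbW => ?_⟩, x, hR⟩
  obtain ⟨c, hc, -, hb, -⟩ := hR
  exact disjoint_left.mp (hnew c hc) hb hbW

/-- All these branches end in the window of `b₀`, so an input up to level `l` costs one plane. An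
input beyond level `l` must meet `W` at some `j > l`, so its output shares `l + 1` symbols with some
`b ∈ W` and differs from `b`. -/
theorem IsWindowState.card_deepPlanes_le_inputs (h : IsWindowState f u S) (hd : 1 ≤ d)
    (hu : u ≤ n) {a b₀ : Word d n} {W : Finset (Word d n)}
    (hnew : ∀ c ∈ S, Disjoint c.outputs W) {k l : ℕ} (hkl : k ≤ l) (hl : l < n) :
    #(deepPlanes S a W k u b₀) ≤ (d ^ l - d ^ k) + #W * (d ^ (n - l - 1) - 1) := by
  have hsub : deepPlanes S a W k u b₀ ⊆
      ((inputsWithin a l \ inputsWithin a k).biUnion fun x => univ.filter fun p =>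
        ∃ b, b.prefix hu = b₀.prefix hu ∧ Reaches S x b p) ∪
      (W.biUnion fun b => ((univ.filter fun b' => AgreeUpTo (l + 1) b b').erase b).biUnion
        fun b' => univ.filter fun p => ∃ x, Reaches S x b' p) := by
    intro p hp
    obtain ⟨x, b', hR, ⟨j, hj, hxj, b, hb, hbb'⟩, hxk, hb'⟩ := (mem_filter.mp hp).2
    simp only [mem_union, mem_biUnion, mem_filter, mem_univ, true_and, mem_sdiff, mem_erase]
    by_cases hxl : x ∈ inputsWithin a l
    · exact Or.inl ⟨x, ⟨hxl, hxk⟩, b', (prefix_eq_prefix_iff hu b' b₀).mpr hb'.symm, hR⟩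
    · refine Or.inr ⟨b, hb, b', ⟨?_, hbb'.mono (lt_of_mem_inputsWithin hxj hxl)⟩, x, hR⟩
      rintro rfl
      obtain ⟨c, hc, -, hbc, -⟩ := hR
      exact disjoint_left.mp (hnew c hc) hbc hb
  refine (card_le_card hsub).trans ((card_union_le _ _).trans (Nat.add_le_add ?_
    (card_biUnion_le_card_mul _ _ _ fun b _ => ?_)))
  · rw [← card_inputsWithin_sdiff hd a hkl hl.le]
    exact (card_biUnion_le_card_mul _ _ 1 fun x _ =>
      h.card_planes_window_le hu x _).trans_eq (mul_one _)
  · have hcard : #((univ.filter fun b' => AgreeUpTo (l + 1) b b').erase b) =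
        d ^ (n - l - 1) - 1 := by
      rw [card_erase_of_mem (mem_filter.mpr ⟨mem_univ b, fun _ _ => rfl⟩), card_agreeUpTo b hl,
        Nat.sub_sub]
    rw [← hcard]
    exact (card_biUnion_le_card_mul _ _ 1 fun b' _ =>
      h.card_planes_output_le b').trans_eq (mul_one _)

/-- If the planes blocked for any part of a window never exhaust all planes, every new request can
be routed. -/
theorem isNonblockingUnderWindow_of_card_lt
    (hcard : ∀ S : Set (Connection d n m), IsWindowState f (n - t) S →
      ∀ (a b₀ : Word d n) (W : Finset (Word d n)), b₀ ∈ W → #W ≤ f →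
        (∀ b ∈ W, AgreeUpTo (n - t) b₀ b) → (∀ c ∈ S, Disjoint c.outputs W) →
        #(blockedPlanes S a W) < m) :
    IsNonblockingUnderWindow d n m f t := by
  intro S hS a B ⟨⟨b₁, hb₁⟩, hBf, hnew⟩
  have hu : n - t ≤ n := Nat.sub_le n t
  have hfree : ∀ b₀ ∈ B, ∃ p, p ∉ blockedPlanes S a (B.filter fun b => AgreeUpTo (n - t) b₀ b) := by
    intro b₀ hb₀
    have hlt := hcard S hS.isWindowState a b₀ (B.filter fun b => AgreeUpTo (n - t) b₀ b)
      (mem_filter.mpr ⟨hb₀, fun _ _ => rfl⟩) ((card_le_card (filter_subset _ _)).trans hBf)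
      (fun b hb => (mem_filter.mp hb).2)
      (fun c hc => disjoint_of_subset_right (filter_subset _ _) (hnew c hc).2)
    by_contra hall
    push Not at hall
    rw [eq_univ_of_forall hall, card_univ, Fintype.card_fin] at hlt
    exact lt_irrefl m hlt
  -- Choosing planes by prefix rather than by output enforces the window rule; prefixes not met by
  -- `B` receive an arbitrary plane.
  have hplane : ∀ v : Word d (n - t), ∃ p : Fin m, ∀ b₀ ∈ B, b₀.prefix hu = v →
      p ∉ blockedPlanes S a (B.filter fun b => AgreeUpTo (n - t) b₀ b) := by
    intro v
    by_cases hv : ∃ b₀ ∈ B, b₀.prefix hu = v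
    · obtain ⟨b₀, hb₀, rfl⟩ := hv
      obtain ⟨p, hp⟩ := hfree b₀ hb₀
      refine ⟨p, fun b hb hbv => ?_⟩
      have hag := (prefix_eq_prefix_iff hu b b₀).mp hbv
      have : (B.filter fun b' => AgreeUpTo (n - t) b b') =
          B.filter fun b' => AgreeUpTo (n - t) b₀ b' :=
        filter_congr fun b' _ => ⟨fun hx => hag.symm.trans hx, fun hx => hag.trans hx⟩
      rwa [this]
    · obtain ⟨p, -⟩ := hfree b₁ hb₁
      exact ⟨p, fun b hb hbv => absurd ⟨b, hb, hbv⟩ hv⟩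
  choose g hg using hplane
  refine ⟨⟨a, B, fun b => g (b.prefix hu)⟩, rfl, rfl, ?_, ?_⟩
  · intro b _ b' _ hbb'
    exact congrArg g ((prefix_eq_prefix_iff hu b b').mpr hbb')
  · rintro c hc ⟨b, hb, b', hb', hp, hlink⟩
    obtain ⟨j, hj, hx, hag⟩ := exists_level_of_routeLinks_inter (hnew c hc).1 hlink
    exact hg _ b hb rfl (mem_filter.mpr ⟨mem_univ _, c.input, b', ⟨c, hc, rfl, hb', hp.symm⟩,
      j, hj, hx, b, mem_filter.mpr ⟨hb, fun _ _ => rfl⟩, hag⟩)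

end Blocking

/-! ### Evaluation of the counts and the five cases of the bound. -/

section Bounds

open Finset

variable {d n m f t u : ℕ}

/-- Each term equals `(d-1)d^(u-1)` minus `d^(u-i+k) - d^(u-i-1+k)`, and the latter differences
telescope. -/
theorem cast_sum_Ioo_mul_sub {k e : ℕ} (hd : 1 ≤ d) (hke : k < e) (he : e ≤ u) :
    ((∑ i ∈ Ioo k e, (d ^ i - d ^ k) * (d ^ (u - i) - d ^ (u - i - 1)) : ℕ) : ℚ) =
      ((e : ℚ) - 1 - k) * ((d : ℚ) - 1) * (d : ℚ) ^ (u - 1) - (d : ℚ) ^ (u - 1) +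
        (d : ℚ) ^ (u - e + k) := by
  induction e, hke using Nat.le_induction with
  | base =>
    have hIoo : Ioo k k.succ = ∅ := by ext i; simp
    rw [Nat.succ_eq_add_one] at hIoo
    rw [hIoo, show u - (k + 1) + k = u - 1 by omega]
    push_cast
    simp
  | succ e hke ih =>
    have hIoo : Ioo k (e + 1) = insert e (Ioo k e) := by ext i; simp; omega
    rw [hIoo, sum_insert (by simp), Nat.cast_add, ih (by omega), Nat.cast_mul,
      Nat.cast_sub (Nat.pow_le_pow_right hd (by omega)),
      Nat.cast_sub (Nat.pow_le_pow_right hd (by omega))]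
    push_cast
    have e1 : u - 1 = e + (u - e - 1) := by omega
    have e2 : u - e = (u - e - 1) + 1 := by omega
    have e3 : u - (e + 1) + k = (u - e - 1) + k := by omega
    rw [e3, e1, e2, Nat.add_sub_cancel]
    ring

theorem mul_zpow_lt_one (hd : 1 ≤ d) {z : ℤ} (hz : z ≤ -1) : ((d : ℚ) - 1) * (d : ℚ) ^ z < 1 := by
  have hD : (1 : ℚ) ≤ d := by exact_mod_cast hd
  have h1 : (d : ℚ) ^ z ≤ (d : ℚ) ^ (-1 : ℤ) := zpow_le_zpow_right₀ hD hz
  have h2 : ((d : ℚ) - 1) * (d : ℚ) ^ z ≤ ((d : ℚ) - 1) * (d : ℚ) ^ (-1 : ℤ) :=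
    mul_le_mul_of_nonneg_left h1 (by linarith)
  have h3 : ((d : ℚ) - 1) * (d : ℚ) ^ (-1 : ℤ) = 1 - (d : ℚ)⁻¹ := by
    rw [zpow_neg_one]; field_simp
  have h4 : (0 : ℚ) < (d : ℚ)⁻¹ := by positivity
  linarith

/-- Balancing the number `q` of requested outputs in a window against the number of inputs. -/
theorem cast_lt_of_le_window {q k x : ℕ} (hd : 1 ≤ d) (hq : 1 ≤ q) (hqt : q ≤ d ^ t) (hku : k ≤ u)
    (h1 : x ≤ d ^ t - q) (h2 : u < t → x ≤ (d ^ (t - 1) - d ^ k) + q * (d ^ u - 1)) :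
    (x : ℚ) < (d : ℚ) ^ t - ((d : ℚ) - 1) * (d : ℚ) ^ ((t : ℤ) - u - 1) := by
  have hq' : (1 : ℚ) ≤ q := by exact_mod_cast hq
  have h1' : (x : ℚ) ≤ (d : ℚ) ^ t - q := by
    have : x + q ≤ d ^ t := by omega
    have : (x : ℚ) + q ≤ (d : ℚ) ^ t := by exact_mod_cast this
    linarith
  have hD : (1 : ℚ) ≤ d := by exact_mod_cast hd
  rcases Nat.lt_or_ge u t with hut | hut
  · obtain ⟨s, rfl⟩ := Nat.exists_eq_add_of_lt hut
    rw [show ((u + s + 1 : ℕ) : ℤ) - u - 1 = (s : ℕ) by push_cast; ring, zpow_natCast]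
    -- Up to the term `-d^k`, the two bounds cross at `q = (d-1)d^s`: the first falls and the second
    -- grows with `q`. At equality, strictness comes from `d^k > 0`.
    rcases lt_or_ge (((d : ℚ) - 1) * (d : ℚ) ^ s) q with hlt | hge
    · linarith
    · have h2' : (x : ℚ) ≤ (d : ℚ) ^ (u + s) - (d : ℚ) ^ k + q * ((d : ℚ) ^ u - 1) := by
        have := h2 hut
        rw [Nat.add_sub_cancel] at this
        have hc : (x : ℚ) ≤ ((d ^ (u + s) - d ^ k + q * (d ^ u - 1) : ℕ) : ℚ) := by
          exact_mod_cast this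
        rw [Nat.cast_add, Nat.cast_mul, Nat.cast_sub (Nat.pow_le_pow_right hd (by omega)),
          Nat.cast_sub (Nat.one_le_pow _ _ hd)] at hc
        push_cast at hc
        exact hc
      have hu1 : (1 : ℚ) ≤ (d : ℚ) ^ u := one_le_pow₀ hD
      have hk1 : (1 : ℚ) ≤ (d : ℚ) ^ k := one_le_pow₀ hD
      have h3 : (q : ℚ) * ((d : ℚ) ^ u - 1) ≤ ((d : ℚ) - 1) * (d : ℚ) ^ s * ((d : ℚ) ^ u - 1) :=
        mul_le_mul_of_nonneg_right hge (by linarith)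
      have h4 : ((d : ℚ) - 1) * (d : ℚ) ^ s * ((d : ℚ) ^ u - 1) =
          (d : ℚ) ^ (u + s + 1) - (d : ℚ) ^ (u + s) - ((d : ℚ) - 1) * (d : ℚ) ^ s := by ring
      linarith
  · have := mul_zpow_lt_one hd (z := (t : ℤ) - u - 1) (by omega)
    linarith

variable {S : Set (Connection d n m)}

theorem IsWindowState.cast_card_blockedPlanes_le (h : IsWindowState f u S) (hd : 1 ≤ d)
    (hu : u ≤ n) (a b₀ : Word d n) {W : Finset (Word d n)} (hW : ∀ b ∈ W, AgreeUpTo u b₀ b)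
    {k e : ℕ} (hke : k < e) (he : e ≤ u) :
    (#(blockedPlanes S a W) : ℚ) ≤ f * ((d : ℚ) ^ k - 1) +
      (((e : ℚ) - 1 - k) * ((d : ℚ) - 1) * (d : ℚ) ^ (u - 1) - (d : ℚ) ^ (u - 1) +
        (d : ℚ) ^ (u - e + k)) + #(deepPlanes S a W k e b₀) := by
  rw [← cast_sum_Ioo_mul_sub hd hke he]
  have := h.card_blockedPlanes_le hd hu a b₀ hW (k := k) (by omega) he
  have hc : (#(blockedPlanes S a W) : ℚ) ≤ _ := Nat.cast_le.mpr this
  rw [Nat.cast_add, Nat.cast_add, Nat.cast_mul, Nat.cast_sub (Nat.one_le_pow _ _ hd)] at hc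
  push_cast at hc ⊢
  linarith

theorem IsWindowState.cast_card_deepPlanes_le_outputs (h : IsWindowState f u S)
    {a b₀ : Word d n} {W : Finset (Word d n)} (hW : ∀ b ∈ W, AgreeUpTo u b₀ b) (hne : W.Nonempty)
    (hd : 1 ≤ d) (hnew : ∀ c ∈ S, Disjoint c.outputs W) {k e : ℕ} (he : e ≤ u) (hu : u ≤ n) :
    (#(deepPlanes S a W k e b₀) : ℚ) ≤ (d : ℚ) ^ (n - e) - 1 := by
  have h1 := h.card_deepPlanes_le_outputs (a := a) (k := k) hW hnew he hu
  have h2 := hne.card_pos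
  have h3 := Nat.one_le_pow (n - e) d hd
  have h4 : #(deepPlanes S a W k e b₀) + 1 ≤ d ^ (n - e) := by omega
  have h5 : (#(deepPlanes S a W k e b₀) : ℚ) + 1 ≤ (d : ℚ) ^ (n - e) := by exact_mod_cast h4
  linarith

/-- Both counts of deep planes are combined, the one by inputs with `l = t - 1`, so that `n - l - 1
= u`. -/
theorem IsWindowState.cast_card_deepPlanes_lt (h : IsWindowState f u S) (hd : 1 ≤ d)
    (hut : u + t = n) {a b₀ : Word d n} {W : Finset (Word d n)}
    (hW : ∀ b ∈ W, AgreeUpTo u b₀ b) (hne : W.Nonempty)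
    (hnew : ∀ c ∈ S, Disjoint c.outputs W) {k : ℕ} (hk : k ≤ u) :
    (#(deepPlanes S a W k u b₀) : ℚ) <
      (d : ℚ) ^ t - ((d : ℚ) - 1) * (d : ℚ) ^ ((t : ℤ) - u - 1) := by
  classical
  have hcard : #W ≤ d ^ t := by
    rw [show t = n - u by omega, ← card_agreeUpTo b₀ (by omega : u ≤ n)]
    exact card_le_card fun b hb => mem_filter.mpr ⟨mem_univ b, hW b hb⟩
  refine cast_lt_of_le_window hd hne.card_pos hcard hk ?_ fun hlt => ?_
  · have := h.card_deepPlanes_le_outputs (a := a) (k := k) hW hnew le_rfl (by omega)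
    rwa [show n - u = t by omega] at this
  · have := h.card_deepPlanes_le_inputs (a := a) (b₀ := b₀) hd (by omega) hnew (k := k)
      (l := t - 1) (by omega) (by omega)
    rwa [show n - (t - 1) - 1 = u by omega] at this

theorem IsWindowState.cast_card_deepPlanes_le_inputs (h : IsWindowState f u S) (hd : 1 ≤ d)
    (hu : u ≤ n) {a b₀ : Word d n} {W : Finset (Word d n)} (hWf : #W ≤ f)
    (hnew : ∀ c ∈ S, Disjoint c.outputs W) {k l : ℕ} (hkl : k ≤ l) (hl : l < n) :
    (#(deepPlanes S a W k u b₀) : ℚ) ≤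
      (d : ℚ) ^ l - (d : ℚ) ^ k + f * ((d : ℚ) ^ (n - l - 1) - 1) := by
  have h1 := (h.card_deepPlanes_le_inputs (a := a) (b₀ := b₀) hd hu hnew hkl hl).trans
    (Nat.add_le_add_left (Nat.mul_le_mul_right _ hWf) _)
  have hc : (#(deepPlanes S a W k u b₀) : ℚ) ≤ _ := Nat.cast_le.mpr h1
  rw [Nat.cast_add, Nat.cast_mul, Nat.cast_sub (Nat.pow_le_pow_right hd hkl),
    Nat.cast_sub (Nat.one_le_pow _ _ hd)] at hc
  push_cast at hc
  exact hc

theorem lt_floor_half_iff (n t : ℕ) : (t : ℤ) < ⌊((n : ℤ) : ℚ) / 2⌋ ↔ 2 * t + 2 ≤ n := by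
  rw [← Int.add_one_le_iff, Int.le_floor, le_div_iff₀ (by norm_num)]
  norm_cast
  omega

theorem card_blockedPlanes_lt_planeBound (hd : 2 ≤ d) (hn : 1 ≤ n) (ht : t ≤ n)
    (h : IsWindowState f (n - t) S) (a b₀ : Word d n) {W : Finset (Word d n)} (hne : W.Nonempty)
    (hWf : #W ≤ f) (hW : ∀ b ∈ W, AgreeUpTo (n - t) b₀ b)
    (hnew : ∀ c ∈ S, Disjoint c.outputs W) :
    (#(blockedPlanes S a W) : ℚ) < 1 + planeBound d n t f := by
  have hd1 : 1 ≤ d := by omega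
  obtain ⟨u, rfl⟩ := Nat.exists_eq_add_of_le' ht
  rw [Nat.add_sub_cancel] at h hW
  have hu : u ≤ u + t := Nat.le_add_right u t
  have hD0 : (d : ℚ) ≠ 0 := by positivity
  simp only [planeBound]
  -- The estimates need only the case inequalities on `r`; the logarithm serves to tune the
  -- cut-offs.
  generalize Nat.log d f = r
  simp only [lt_floor_half_iff]
  have eT : ((u + t : ℕ) : ℤ) - t = u := by push_cast; ring
  have e2 : 2 * (t : ℤ) - ((u + t : ℕ) : ℤ) - 1 = (t : ℤ) - u - 1 := by push_cast; ring
  split_ifs with c1 c2 c3 c4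
  · set z : ℤ := ⌈((((u + t : ℕ) : ℤ) - (r : ℤ) : ℤ) : ℚ) / 2⌉ with hz
    have z1 : ((u + t : ℕ) : ℤ) - r ≤ 2 * z := by
      have := Int.le_ceil (((((u + t : ℕ) : ℤ) - (r : ℤ) : ℤ) : ℚ) / 2)
      rw [← hz, div_le_iff₀ (by norm_num)] at this
      have : ((((u + t : ℕ) : ℤ) - r : ℤ) : ℚ) ≤ ((z * 2 : ℤ) : ℚ) := by push_cast at this ⊢; linarith
      have := Int.cast_le.mp this
      omega
    have z2 : 2 * z < ((u + t : ℕ) : ℤ) - r + 2 := by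
      have := Int.ceil_lt_add_one (((((u + t : ℕ) : ℤ) - (r : ℤ) : ℤ) : ℚ) / 2)
      rw [← hz] at this
      have : ((2 * z : ℤ) : ℚ) < ((((u + t : ℕ) : ℤ) - r + 2 : ℤ) : ℚ) := by
        push_cast at this ⊢; linarith
      exact Int.cast_lt.mp this
    clear_value z
    -- With `e = k + 1` there are no intermediate windows; this `k` roughly balances `f * d^k`
    -- against `d^(n-k-1)`.
    obtain ⟨k, rfl⟩ : ∃ k : ℕ, z = k + 1 := ⟨(z - 1).toNat, by omega⟩
    have hb := h.cast_card_blockedPlanes_le hd1 hu a b₀ hW (Nat.lt_succ_self k) (by omega)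
    have hdp := h.cast_card_deepPlanes_le_outputs (a := a) (k := k) (e := k + 1) hW hne hd1 hnew
      (by omega) hu
    rw [show u - k.succ + k = u - 1 by omega] at hb
    rw [show (k : ℤ) + 1 - 1 = (k : ℕ) by ring,
      show ((u + t : ℕ) : ℤ) - (k + 1) = ((u + t - (k + 1) : ℕ) : ℤ) by omega,
      zpow_natCast, zpow_natCast]
    push_cast at hb
    linarith
  -- `k = 0` removes the term with `f`, and `e = t + 1` makes the `d^(u-1)` deep outputs cancel the
  -- `-d^(u-1)` of the layer sum.
  · have hb := h.cast_card_blockedPlanes_le hd1 hu a b₀ hW (Nat.succ_pos t) (by omega)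
    have hdp := h.cast_card_deepPlanes_le_outputs (a := a) (k := 0) (e := t + 1) hW hne hd1 hnew
      (by omega) hu
    rw [eT, show (u : ℤ) - 1 = ((u - 1 : ℕ) : ℤ) by omega,
      show ((u + t : ℕ) : ℤ) - 2 * t - 1 = ((u - (t + 1) : ℕ) : ℤ) by omega,
      zpow_natCast, zpow_natCast]
    rw [show u + t - (t + 1) = u - 1 by omega] at hdp
    push_cast at hb
    simp only [pow_zero, add_zero, Nat.succ_eq_add_one] at hb
    linarith
  · have hdp := h.cast_card_deepPlanes_lt (a := a) (k := 0) hd1 rfl hW hne hnew (Nat.zero_le u)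
    rw [eT, e2, zpow_natCast]
    -- For `u = 0` no cut-off `k < e ≤ u` exists and the closed form is unavailable; all blocked
    -- planes are then deep.
    rcases Nat.eq_zero_or_pos u with rfl | hupos
    · have hb := h.card_blockedPlanes_le hd1 hu a b₀ hW (k := 0) (Nat.zero_le _) le_rfl
      simp only [pow_zero, Nat.sub_self, zero_mul, Ioo_self, sum_empty, zero_add] at hb
      have hb' : (#(blockedPlanes S a W) : ℚ) ≤ #(deepPlanes S a W 0 0 b₀) := by exact_mod_cast hb
      have : (((0 + t : ℕ) : ℚ) - t - 1) * ((d : ℚ) - 1) - 1 = - d := by push_cast; ring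
      rw [this, show ((0 : ℕ) : ℤ) - 1 = -1 by norm_num, zpow_neg_one, neg_mul, mul_inv_cancel₀ hD0]
      linarith
    · have hb := h.cast_card_blockedPlanes_le hd1 hu a b₀ hW hupos le_rfl
      rw [show (u : ℤ) - 1 = ((u - 1 : ℕ) : ℤ) by omega, zpow_natCast]
      simp only [Nat.sub_self, pow_zero, add_zero, Nat.cast_zero] at hb
      push_cast
      linarith
  -- Here `f * d^k` is about `d^(u-1)`, where raising `k` stops paying off against one more layer.
  · have hdp := h.cast_card_deepPlanes_lt (a := a) (k := u - r - 1) hd1 rfl hW hne hnew (by omega)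
    have hb := h.cast_card_blockedPlanes_le hd1 hu a b₀ hW (k := u - r - 1) (by omega) le_rfl
    rw [eT, e2, show (u : ℤ) - 1 = ((u - 1 : ℕ) : ℤ) by omega,
      show (u : ℤ) - r - 1 = ((u - r - 1 : ℕ) : ℤ) by omega]
    simp only [zpow_natCast, Int.cast_natCast]
    have hr : (u : ℚ) - 1 - ((u - r - 1 : ℕ) : ℚ) = r := by
      rw [Nat.sub_sub, Nat.cast_sub (by omega)]; push_cast; ring
    rw [hr, Nat.sub_self, zero_add] at hb
    linarith
  · set z : ℤ := ⌊((((u + t : ℕ) : ℤ) + (r : ℤ) : ℤ) : ℚ) / 2⌋ with hz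
    have z1 : 2 * z ≤ ((u + t : ℕ) : ℤ) + r := by
      have := Int.floor_le (((((u + t : ℕ) : ℤ) + (r : ℤ) : ℤ) : ℚ) / 2)
      rw [← hz] at this
      have : ((2 * z : ℤ) : ℚ) ≤ ((((u + t : ℕ) : ℤ) + r : ℤ) : ℚ) := by
        push_cast at this ⊢; linarith
      exact Int.cast_le.mp this
    have z2 : ((u + t : ℕ) : ℤ) + r < 2 * z + 2 := by
      have := Int.lt_floor_add_one (((((u + t : ℕ) : ℤ) + (r : ℤ) : ℤ) : ℚ) / 2)
      rw [← hz] at this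
      have : ((((u + t : ℕ) : ℤ) + r : ℤ) : ℚ) < ((2 * z + 2 : ℤ) : ℚ) := by
        push_cast at this ⊢; linarith
      exact Int.cast_lt.mp this
    clear_value z
    -- This `l` roughly balances the inputs `d^l` against the outputs `f * d^(n-l-1)`; the `-d^k` of
    -- the deep count cancels the `d^k` of the layer sum.
    obtain ⟨l, rfl⟩ : ∃ l : ℕ, z = l := ⟨z.toNat, by omega⟩
    have hdp := h.cast_card_deepPlanes_le_inputs (a := a) (b₀ := b₀) (k := u - r - 1) (l := l) hd1
      hu hWf hnew (by omega) (by omega)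
    have hb := h.cast_card_blockedPlanes_le hd1 hu a b₀ hW (k := u - r - 1) (by omega) le_rfl
    rw [eT, show (u : ℤ) - 1 = ((u - 1 : ℕ) : ℤ) by omega,
      show (u : ℤ) - r - 1 = ((u - r - 1 : ℕ) : ℤ) by omega,
      show ((u + t : ℕ) : ℤ) - l - 1 = ((u + t - l - 1 : ℕ) : ℤ) by omega]
    simp only [zpow_natCast, Int.cast_natCast]
    have hr : (u : ℚ) - 1 - ((u - r - 1 : ℕ) : ℚ) = r := by
      rw [Nat.sub_sub, Nat.cast_sub (by omega)]; push_cast; ring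
    rw [hr, Nat.sub_self, zero_add] at hb
    linarith

end Bounds

theorem mainTheorem4 (d n m f t : ℕ) (hd : 2 ≤ d) (hn : 1 ≤ n)
    (hf : 1 ≤ f) (hfN : f ≤ d ^ n) (ht : t ≤ n)
    (hm : 1 + planeBound d n t f ≤ (m : ℚ)) :
    IsNonblockingUnderWindow d n m f t := by
  refine isNonblockingUnderWindow_of_card_lt fun S hS a b₀ W hb₀ hWf hW hnew => ?_
  exact_mod_cast (card_blockedPlanes_lt_planeBound hd hn ht hS a b₀ ⟨b₀, hb₀⟩ hWf hW hnew).trans_le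
    hm
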